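/- Let $K$ be an algebraically closed field (of arbitrary characteristic), let $G$ be an affine algebraic group over $K$ (not necessarily connected), and let $m,n\ge 0$ be integers. Let $w_1,\dots,w_n$ be elements of the free product $G * F(x_1,\dots,x_m)$ of $G$ and the free group on $x_1,\dots,x_m$, and consider the system of equations $w_1=1,\dots,w_n=1$ in the $m$ unknowns $x_1,\dots,x_m$; its solution variety is the set of all $(g_1,\dots,g_m)\in G^m$ such that each $w_i$ becomes $1$ when every $x_j$ is replaced by $g_j$. Then every irreducible component $C$ of the solution variety (in the Zariski topology) satisfies $$\dim C \;\ge\; (m-n)\cdot\dim G .$$ -/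

import Mathlib

open MvPolynomial
open scoped Topology

noncomputable section

namespace AlgGroupEq

universe u v w

/-- The Zariski topology on the affine space `K^σ`: the closed sets are the common zero loci of
sets (equivalently, ideals) of polynomials. -/
abbrev zariskiTopology (K : Type u) [Field K] (σ : Type w) : TopologicalSpace (σ → K) :=
  TopologicalSpace.ofClosed {V | ∃ I : Ideal (MvPolynomial σ K), V = zeroLocus K I}
    ⟨⊤, by simp⟩
    (by
      intro A hA
      refine ⟨Ideal.span {p | ∃ V ∈ A, p ∈ vanishingIdeal K V}, ?_⟩
      rw [zeroLocus_span]
      ext x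
      simp only [Set.mem_sInter, Set.mem_ofPred_eq]
      constructor
      · rintro hx p ⟨V, hV, hp⟩
        exact hp x (hx V hV)
      · intro hx V hV
        obtain ⟨I, rfl⟩ := hA hV
        exact fun p hp => hx p ⟨_, hV, le_vanishingIdeal_zeroLocus I hp⟩)
    (by
      rintro _ ⟨I, rfl⟩ _ ⟨J, rfl⟩
      refine ⟨I ⊓ J, Set.ext fun x => ⟨?_, fun hx => ?_⟩⟩
      · rintro (hx | hx) p hp
        · exact hx p hp.1
        · exact hx p hp.2
      · by_contra hcon
        simp only [Set.mem_union, mem_zeroLocus_iff, not_or, not_forall] at hcon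
        obtain ⟨⟨p, hp, hpx⟩, q, hq, hqx⟩ := hcon
        have h := hx (p * q) ⟨I.mul_mem_right q hp, J.mul_mem_left p hq⟩
        rw [map_mul] at h
        exact (mul_ne_zero hpx hqx) h)

/-- The dimension of a subset of affine space: the supremum of the lengths of chains of irreducible
closed subsets, for the subspace topology of the Zariski topology. -/
def zariskiDim {K : Type u} [Field K] {σ : Type w} (V : Set (σ → K)) : WithBot ℕ∞ :=
  letI : TopologicalSpace (σ → K) := zariskiTopology K σ
  topologicalKrullDim V

/-- The irreducible components of a subset `V` of affine space: the maximal irreducible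
(in particular nonempty) subsets of `V`, for the Zariski topology. -/
def zariskiComponents {K : Type u} [Field K] {σ : Type w} (V : Set (σ → K)) :
    Set (Set (σ → K)) :=
  letI : TopologicalSpace (σ → K) := zariskiTopology K σ
  {C | Maximal (fun T : Set (σ → K) => IsIrreducible T ∧ T ⊆ V) C}

/-- The structure of an affine algebraic group over `K` on an abstract group `G`: an identification
of `G` with a Zariski closed subset of an affine space `K^N` for which the multiplication
`G × G → G` and the inversion `G → G` are morphisms of affine varieties, that is, are given by
polynomials in the coordinates. -/
structure AffineAlgebraicGroup (K : Type u) [Field K] (G : Type v) [Group G] where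
  /-- the dimension of the ambient affine space -/
  N : ℕ
  /-- the coordinates of an element of the group -/
  coord : G → (Fin N → K)
  coord_injective : Function.Injective coord
  isClosed_range : IsClosed[zariskiTopology K (Fin N)] (Set.range coord)
  mul_regular : ∀ i : Fin N, ∃ P : MvPolynomial (Fin N ⊕ Fin N) K,
    ∀ g h : G, coord (g * h) i = eval (Sum.elim (coord g) (coord h)) P
  inv_regular : ∀ i : Fin N, ∃ P : MvPolynomial (Fin N) K,
    ∀ g : G, coord g⁻¹ i = eval (coord g) P

namespace AffineAlgebraicGroup

variable {K : Type u} [Field K] {G : Type v} [Group G]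

/-- The dimension of an affine algebraic group. -/
def dim (A : AffineAlgebraicGroup K G) : WithBot ℕ∞ :=
  zariskiDim (Set.range A.coord)

/-- The coordinates on the power `G^m`, which embed it into the affine space `K^(m * N)`. -/
def powCoord (A : AffineAlgebraicGroup K G) (m : ℕ) (x : Fin m → G) : Fin m × Fin A.N → K :=
  fun p => A.coord (x p.1) p.2

end AffineAlgebraicGroup

/-- The value of a word `w` in the free product `G * F(x_1, …, x_m)` at a tuple
`(g_1, …, g_m)` of elements of `G`: the coefficients are kept and `x_j` is replaced by `g_j`. -/
def wordEval {G : Type v} [Group G] {m : ℕ} (x : Fin m → G) :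
    Monoid.Coprod G (FreeGroup (Fin m)) →* G :=
  Monoid.Coprod.lift (MonoidHom.id G) (FreeGroup.lift x)

/-- The solutions in `G^m` of the system of equations `w_1 = 1, …, w_n = 1`. -/
def solutionSet {G : Type v} [Group G] {m n : ℕ}
    (w : Fin n → Monoid.Coprod G (FreeGroup (Fin m))) : Set (Fin m → G) :=
  {x | ∀ i, wordEval x (w i) = 1}

/-- The solution variety of a system of equations over an affine algebraic group, as a subset of
the affine space into which `G^m` is embedded. -/
def solutionVariety {K : Type u} [Field K] {G : Type v} [Group G]
    (A : AffineAlgebraicGroup K G) {m n : ℕ}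
    (w : Fin n → Monoid.Coprod G (FreeGroup (Fin m))) : Set (Fin m × Fin A.N → K) :=
  A.powCoord m '' solutionSet w

end AlgGroupEq

end

noncomputable section

namespace AlgGroupEq

/-! Let `d = dim G`, and work in the algebras of regular functions on `G` and `G^m`. The maximal
ideal of `1` has height at most `d`, so by the converse of Krull's height theorem it is minimal over
an ideal generated by at most `d` functions. Pulling these back along the `n` word maps gives at
most `n * d` functions on `G^m`. They may have common zeros outside the solution variety, but not
near a solution `x`: a prime below the ideal of `x` that contains them contracts, along each word
map, to a prime between their span and the ideal of `1`, hence to the ideal of `1` itself.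

Choose `x` on the component `C` and on no other component (`exists_mem_zeros_forall_le`). Then the
primes between the pulled-back functions and the ideal of `x` all contain the ideal of `C`, and
Krull's height theorem bounds the height of the ideal of `x` by `dim C + n * d`. The same height is
at least `m * d` (`mul_dim_le_height`): homogeneity of `G` moves a longest chain of primes to any
point, and products of irreducible sets are irreducible, so chains in the `m` factors can be
concatenated. -/

lemma isIrreducible_of_isIrreducible_image {X Y : Type*} [TopologicalSpace X] [TopologicalSpace Y]
    {f : X → Y} (hf : Topology.IsInducing f) {T : Set X} (hT : IsIrreducible (f '' T)) :
    IsIrreducible T := by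
  refine ⟨Set.image_nonempty.1 hT.1, fun U V hU hV => ?_⟩
  obtain ⟨U', hU', rfl⟩ := hf.isOpen_iff.1 hU
  obtain ⟨V', hV', rfl⟩ := hf.isOpen_iff.1 hV
  rintro ⟨x, hx, hxU⟩ ⟨y, hy, hyV⟩
  obtain ⟨_, ⟨z, hz, rfl⟩, hzUV⟩ := hT.2 U' V' hU' hV'
    ⟨f x, ⟨x, hx, rfl⟩, hxU⟩ ⟨f y, ⟨y, hy, rfl⟩, hyV⟩
  exact ⟨z, hz, hzUV⟩

/-! ### Regular functions, the Nullstellensatz and dimension -/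

section Regular

variable {K : Type*} [Field K] {X : Type*} {σ : Type*}

/-- The algebra of regular functions on `X`, for the coordinates `ι : X → K^σ`: the functions that
are polynomials in the coordinates. -/
def regularFunctions (ι : X → σ → K) : Subalgebra K (X → K) :=
  (aeval (R := K) (fun i x => ι x i)).range

lemma aeval_coordinates_apply (ι : X → σ → K) (p : MvPolynomial σ K) (x : X) :
    aeval (R := K) (fun i x => ι x i) p x = eval (ι x) p := by
  induction p using MvPolynomial.induction_on with
  | C a => simp
  | add p q hp hq => simp [hp, hq]
  | mul_X p i hp => simp [hp]

/-- The regular function given by a polynomial. -/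
def ofPolynomial (ι : X → σ → K) : MvPolynomial σ K →ₐ[K] regularFunctions ι :=
  (aeval (R := K) (fun i x => ι x i)).rangeRestrict

lemma ofPolynomial_apply (ι : X → σ → K) (p : MvPolynomial σ K) (x : X) :
    (ofPolynomial ι p : X → K) x = eval (ι x) p :=
  aeval_coordinates_apply ι p x

lemma ofPolynomial_surjective (ι : X → σ → K) : Function.Surjective (ofPolynomial ι) :=
  AlgHom.rangeRestrict_surjective _

instance [Finite σ] (ι : X → σ → K) : IsNoetherianRing (regularFunctions ι) :=
  isNoetherianRing_of_surjective _ _ (ofPolynomial ι).toRingHom (ofPolynomial_surjective ι)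

lemma ringKrullDim_regularFunctions_le [Finite σ] (ι : X → σ → K) :
    ringKrullDim (regularFunctions ι) ≤ Nat.card σ := by
  refine (ringKrullDim_le_of_surjective (ofPolynomial ι).toRingHom
    (ofPolynomial_surjective ι)).trans ?_
  rw [MvPolynomial.ringKrullDim_of_isNoetherianRing, ringKrullDim_eq_zero_of_field, zero_add]

/-- The ideal of the regular functions that vanish on a set. -/
def functionsVanishingOn (ι : X → σ → K) (T : Set X) : Ideal (regularFunctions ι) where
  carrier := {f | ∀ x ∈ T, (f : X → K) x = 0}
  zero_mem' _ _ := rfl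
  add_mem' {f g} hf hg x hx := by simp [hf x hx, hg x hx]
  smul_mem' f g hg x hx := by simp [hg x hx]

lemma mem_functionsVanishingOn {ι : X → σ → K} {T : Set X} {f : regularFunctions ι} :
    f ∈ functionsVanishingOn ι T ↔ ∀ x ∈ T, (f : X → K) x = 0 := Iff.rfl

/-- The common zeros of the functions of an ideal. -/
def zeros {ι : X → σ → K} (I : Ideal (regularFunctions ι)) : Set X :=
  {x | ∀ f ∈ I, (f : X → K) x = 0}

lemma mem_zeros {ι : X → σ → K} {I : Ideal (regularFunctions ι)} {x : X} :
    x ∈ zeros I ↔ ∀ f ∈ I, (f : X → K) x = 0 := Iff.rfl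

lemma functionsVanishingOn_anti {ι : X → σ → K} {S T : Set X} (h : S ⊆ T) :
    functionsVanishingOn ι T ≤ functionsVanishingOn ι S := fun _ hf x hx => hf x (h hx)

lemma zeros_anti {ι : X → σ → K} {I J : Ideal (regularFunctions ι)} (h : I ≤ J) :
    zeros J ⊆ zeros I := fun _ hx f hf => hx f (h hf)

lemma subset_zeros_functionsVanishingOn (ι : X → σ → K) (T : Set X) :
    T ⊆ zeros (functionsVanishingOn ι T) := fun x hx _ hf => hf x hx

instance functionsVanishingOn_singleton_isPrime (ι : X → σ → K) (x : X) :
    (functionsVanishingOn ι {x}).IsPrime where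
  ne_top' h := by
    have := (Ideal.eq_top_iff_one _).1 h x rfl
    simp at this
  mem_or_mem' {f g} h := by
    have := h x rfl
    simpa [mem_functionsVanishingOn] using this

/-- Irreducibility as "nonempty basic open sets meet". In this form it can be checked by exhibiting
points, as is done for products. -/
lemma isPrime_functionsVanishingOn_iff {ι : X → σ → K} {T : Set X} :
    (functionsVanishingOn ι T).IsPrime ↔ T.Nonempty ∧ ∀ f g : regularFunctions ι,
      (∃ x ∈ T, (f : X → K) x ≠ 0) → (∃ x ∈ T, (g : X → K) x ≠ 0) →
      ∃ x ∈ T, (f : X → K) x ≠ 0 ∧ (g : X → K) x ≠ 0 := by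
  constructor
  · refine fun h => ⟨?_, fun f g hf hg => ?_⟩
    · by_contra hT
      rw [Set.not_nonempty_iff_eq_empty] at hT
      exact h.ne_top ((Ideal.eq_top_iff_one _).2 (by simp [hT, mem_functionsVanishingOn]))
    · by_contra! hcon
      have : f * g ∈ functionsVanishingOn ι T := fun x hx => by
        by_cases h0 : (f : X → K) x = 0
        · simp [h0]
        · simp [hcon x hx h0]
      obtain ⟨x, hx, hfx⟩ := hf
      obtain ⟨y, hy, hgy⟩ := hg
      exact (h.mem_or_mem this).elim (fun h => hfx (h x hx)) (fun h => hgy (h y hy))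
  · rintro ⟨⟨x, hx⟩, h⟩
    refine ⟨fun htop => ?_, fun {f g} hfg => ?_⟩
    · have := (Ideal.eq_top_iff_one _).1 htop x hx
      simp at this
    · by_contra! hcon
      simp only [mem_functionsVanishingOn, not_forall] at hcon
      obtain ⟨⟨y, hy, hfy⟩, z, hz, hgz⟩ := hcon
      obtain ⟨t, ht, hft, hgt⟩ := h f g ⟨y, hy, hfy⟩ ⟨z, hz, hgz⟩
      have := hfg t ht
      simp [hft, hgt] at this

lemma isClosed_zariski_iff {V : Set (σ → K)} :
    IsClosed[zariskiTopology K σ] V ↔ ∃ I : Ideal (MvPolynomial σ K), V = zeroLocus K I := by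
  rw [← @isOpen_compl_iff _ _ (zariskiTopology K σ)]
  change Vᶜᶜ ∈ _ ↔ _
  rw [compl_compl]
  rfl

lemma isOpen_zariski_iff {V : Set (σ → K)} :
    IsOpen[zariskiTopology K σ] V ↔ ∃ I : Ideal (MvPolynomial σ K), V = (zeroLocus K I)ᶜ := by
  rw [← @isClosed_compl_iff _ (zariskiTopology K σ), isClosed_zariski_iff]
  exact exists_congr fun I => ⟨fun h => by rw [← h, compl_compl], fun h => by rw [h, compl_compl]⟩

lemma isOpen_ne_zero (p : MvPolynomial σ K) :
    IsOpen[zariskiTopology K σ] {v : σ → K | eval v p ≠ 0} := by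
  refine isOpen_zariski_iff.2 ⟨Ideal.span {p}, ?_⟩
  rw [zeroLocus_span]
  ext v
  simp [aeval_eq_eval]

/-- The nonvanishing loci of polynomials form a basis of the Zariski topology, so irreducibility
need only be tested on them. -/
theorem isIrreducible_image_iff {ι : X → σ → K} {T : Set X} :
    @IsIrreducible _ (zariskiTopology K σ) (ι '' T) ↔ (functionsVanishingOn ι T).IsPrime := by
  rw [isPrime_functionsVanishingOn_iff]
  constructor
  · rintro ⟨hne, h⟩
    refine ⟨Set.image_nonempty.1 hne, fun f g => ?_⟩
    obtain ⟨p, rfl⟩ := ofPolynomial_surjective ι f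
    obtain ⟨q, rfl⟩ := ofPolynomial_surjective ι g
    simp only [ofPolynomial_apply]
    rintro ⟨x, hx, hpx⟩ ⟨y, hy, hqy⟩
    obtain ⟨_, ⟨z, hz, rfl⟩, hpz, hqz⟩ := h _ _ (isOpen_ne_zero p) (isOpen_ne_zero q)
      ⟨ι x, ⟨x, hx, rfl⟩, hpx⟩ ⟨ι y, ⟨y, hy, rfl⟩, hqy⟩
    exact ⟨z, hz, hpz, hqz⟩
  · rintro ⟨hne, h⟩
    refine ⟨hne.image ι, fun U V hU hV => ?_⟩
    obtain ⟨I, rfl⟩ := isOpen_zariski_iff.1 hU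
    obtain ⟨J, rfl⟩ := isOpen_zariski_iff.1 hV
    rintro ⟨_, ⟨x, hx, rfl⟩, hpx⟩ ⟨_, ⟨y, hy, rfl⟩, hqy⟩
    simp only [Set.mem_compl_iff, mem_zeroLocus_iff, not_forall] at hpx hqy
    obtain ⟨p, hp, hpx⟩ := hpx
    obtain ⟨q, hq, hqy⟩ := hqy
    obtain ⟨z, hz, hpz, hqz⟩ := h (ofPolynomial ι p) (ofPolynomial ι q)
      ⟨x, hx, by rwa [ofPolynomial_apply]⟩ ⟨y, hy, by rwa [ofPolynomial_apply]⟩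
    rw [ofPolynomial_apply] at hpz hqz
    exact ⟨ι z, ⟨z, hz, rfl⟩, fun h => hpz (h p hp), fun h => hqz (h q hq)⟩

lemma mem_zeros_iff_mem_zeroLocus {ι : X → σ → K} {I : Ideal (regularFunctions ι)} {x : X} :
    x ∈ zeros I ↔ ι x ∈ zeroLocus K (I.comap (ofPolynomial ι)) := by
  simp only [mem_zeros, mem_zeroLocus_iff, Ideal.mem_comap, aeval_eq_eval]
  constructor
  · intro h p hp
    simpa [ofPolynomial_apply] using h _ hp
  · intro h f hf
    obtain ⟨p, rfl⟩ := ofPolynomial_surjective ι f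
    simpa [ofPolynomial_apply] using h p hf

lemma isClosed_image_zeros {ι : X → σ → K} (hι : IsClosed[zariskiTopology K σ] (Set.range ι))
    (I : Ideal (regularFunctions ι)) : IsClosed[zariskiTopology K σ] (ι '' zeros I) := by
  have : ι '' zeros I = Set.range ι ∩ zeroLocus K (I.comap (ofPolynomial ι)) := by
    ext v
    constructor
    · rintro ⟨x, hx, rfl⟩
      exact ⟨⟨x, rfl⟩, mem_zeros_iff_mem_zeroLocus.1 hx⟩
    · rintro ⟨⟨x, rfl⟩, hx⟩
      exact ⟨x, mem_zeros_iff_mem_zeroLocus.2 hx, rfl⟩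
  rw [this]
  let := zariskiTopology K σ
  exact hι.inter (isClosed_zariski_iff.2 ⟨_, rfl⟩)

/-- The Nullstellensatz for the prime ideals of the algebra of regular functions. -/
theorem functionsVanishingOn_zeros [IsAlgClosed K] [Finite σ] {ι : X → σ → K}
    (hι : IsClosed[zariskiTopology K σ] (Set.range ι)) (Q : Ideal (regularFunctions ι))
    [Q.IsPrime] : functionsVanishingOn ι (zeros Q) = Q := by
  refine le_antisymm (fun f hf => ?_) fun f hf x hx => hx f hf
  obtain ⟨p, rfl⟩ := ofPolynomial_surjective ι f
  obtain ⟨J, hJ⟩ := isClosed_zariski_iff.1 hι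
  have key : p ∈ vanishingIdeal K (zeroLocus K (Q.comap (ofPolynomial ι))) := by
    intro v hv
    -- The equations of `X` restrict to zero on `X`, so the zero locus of the contracted prime
    -- contains no points outside the image of `X`.
    have hker : J ≤ Q.comap (ofPolynomial ι) := fun q hq => by
      have : ofPolynomial ι q = 0 := by
        ext x
        have hx : ι x ∈ zeroLocus K J := hJ ▸ ⟨x, rfl⟩
        simpa [ofPolynomial_apply, aeval_eq_eval] using hx q hq
      simp [Ideal.mem_comap, this]
    have hv' : v ∈ Set.range ι := hJ ▸ zeroLocus_anti_mono hker hv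
    obtain ⟨x, rfl⟩ := hv'
    have := hf x (mem_zeros_iff_mem_zeroLocus.2 hv)
    rwa [ofPolynomial_apply] at this
  rwa [IsPrime.vanishingIdeal_zeroLocus] at key

/-- A maximal ideal of the algebra of regular functions is the ideal of a point. -/
theorem exists_eq_functionsVanishingOn_singleton [IsAlgClosed K] [Finite σ] {ι : X → σ → K}
    (hι : IsClosed[zariskiTopology K σ] (Set.range ι)) (M : Ideal (regularFunctions ι))
    [hM : M.IsMaximal] : ∃ x, M = functionsVanishingOn ι {x} := by
  have h := functionsVanishingOn_zeros hι M
  obtain ⟨x, hx⟩ := (isPrime_functionsVanishingOn_iff.1 (h.symm ▸ hM.isPrime)).1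
  refine ⟨x, hM.eq_of_le (functionsVanishingOn_singleton_isPrime ι x).ne_top ?_⟩
  rintro f hf _ rfl
  exact hx f hf

lemma zeros_functionsVanishingOn_singleton {ι : X → σ → K} (hinj : Function.Injective ι) (x : X) :
    zeros (functionsVanishingOn ι {x}) = {x} := by
  refine Set.Subset.antisymm (fun y hy => hinj (funext fun i => ?_))
    (subset_zeros_functionsVanishingOn ι _)
  have := hy (ofPolynomial ι (MvPolynomial.X i - C (ι x i))) (by
    rintro _ rfl
    simp [ofPolynomial_apply])
  simpa [ofPolynomial_apply, sub_eq_zero] using this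

/-- The dimension of a closed set bounds the lengths of the chains of primes above its ideal. -/
theorem krullDim_primes_le_zariskiDim [IsAlgClosed K] [Finite σ] {ι : X → σ → K}
    (hι : IsClosed[zariskiTopology K σ] (Set.range ι)) (hinj : Function.Injective ι) {T : Set X}
    (hT : zeros (functionsVanishingOn ι T) ⊆ T) :
    Order.krullDim {Q : PrimeSpectrum (regularFunctions ι) //
      functionsVanishingOn ι T ≤ Q.asIdeal} ≤ zariskiDim (ι '' T) := by
  let := zariskiTopology K σ
  unfold zariskiDim topologicalKrullDim
  rw [← Order.krullDim_orderDual]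
  have himage : ∀ Q : {Q : PrimeSpectrum (regularFunctions ι) //
      functionsVanishingOn ι T ≤ Q.asIdeal},
      Subtype.val '' (Subtype.val ⁻¹' (ι '' zeros Q.1.asIdeal) : Set (ι '' T)) =
        ι '' zeros Q.1.asIdeal := fun Q => by
    rw [Subtype.image_preimage_coe, Set.inter_eq_right]
    exact Set.image_mono ((zeros_anti Q.2).trans hT)
  refine Order.krullDim_le_of_strictMono (fun Q =>
    ⟨Subtype.val ⁻¹' (ι '' zeros (OrderDual.ofDual Q).1.asIdeal), ?_, ?_⟩) ?_
  · refine isIrreducible_of_isIrreducible_image Topology.IsInducing.subtypeVal ?_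
    rw [himage, isIrreducible_image_iff, functionsVanishingOn_zeros hι]
    infer_instance
  · exact (isClosed_image_zeros hι _).preimage continuous_subtype_val
  · intro Q Q' hlt
    have hlt' : (OrderDual.ofDual Q').1.asIdeal < (OrderDual.ofDual Q).1.asIdeal := hlt
    refine lt_of_le_of_ne (fun v hv => Set.image_mono (zeros_anti hlt'.le) hv) fun heq => ?_
    have h1 : ι '' zeros (OrderDual.ofDual Q).1.asIdeal =
        ι '' zeros (OrderDual.ofDual Q').1.asIdeal := by
      rw [← himage (OrderDual.ofDual Q), ← himage (OrderDual.ofDual Q')]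
      exact congrArg (fun Z : TopologicalSpace.IrreducibleCloseds (ι '' T) =>
        Subtype.val '' (Z : Set (ι '' T))) heq
    have h2 := congrArg (functionsVanishingOn ι) (hinj.image_injective h1)
    rw [functionsVanishingOn_zeros hι, functionsVanishingOn_zeros hι] at h2
    exact hlt'.ne h2.symm

/-- No Nullstellensatz is needed in this direction: a relatively closed set is recovered from the
functions vanishing on it. -/
theorem zariskiDim_range_le_ringKrullDim (ι : X → σ → K) :
    zariskiDim (Set.range ι) ≤ ringKrullDim (regularFunctions ι) := by
  let := zariskiTopology K σ
  unfold zariskiDim topologicalKrullDim ringKrullDim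
  rw [← Order.krullDim_orderDual (α := PrimeSpectrum _)]
  have himage : ∀ Z : Set (Set.range ι),
      ι '' {x | (⟨ι x, x, rfl⟩ : Set.range ι) ∈ Z} = Subtype.val '' Z := fun Z => by
    ext v
    constructor
    · rintro ⟨x, hx, rfl⟩
      exact ⟨_, hx, rfl⟩
    · rintro ⟨⟨_, x, rfl⟩, hx, rfl⟩
      exact ⟨x, hx, rfl⟩
  refine Order.krullDim_le_of_strictMono (fun Z => OrderDual.toDual
    ⟨functionsVanishingOn ι {x | (⟨ι x, x, rfl⟩ : Set.range ι) ∈ (Z : Set (Set.range ι))}, ?_⟩) ?_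
  · rw [← isIrreducible_image_iff, himage]
    exact Z.isIrreducible.image _ continuous_subtype_val.continuousOn
  · intro Z Z' hlt
    refine lt_of_le_not_ge (functionsVanishingOn_anti fun x hx => hlt.le hx) fun hge => ?_
    refine hlt.not_ge ?_
    obtain ⟨V, hV, hVZ⟩ := isClosed_induced_iff.1 Z.isClosed
    obtain ⟨J, rfl⟩ := isClosed_zariski_iff.1 hV
    rintro ⟨_, x, rfl⟩ hx
    change _ ∈ (Z : Set (Set.range ι))
    rw [← hVZ]
    intro p hp
    have := hge (show ofPolynomial ι p ∈ functionsVanishingOn ι _ from fun y hy => by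
      rw [Set.mem_ofPred_eq, ← hVZ] at hy
      simpa [ofPolynomial_apply, aeval_eq_eval] using hy p hp) x hx
    simpa [ofPolynomial_apply, aeval_eq_eval] using this

lemma zariskiDim_mono {V W : Set (σ → K)} (h : V ⊆ W) : zariskiDim V ≤ zariskiDim W := by
  let := zariskiTopology K σ
  exact (Topology.IsEmbedding.inclusion h).isInducing.topologicalKrullDim_le

/-- Rules out the values `⊥` and `⊤`, so that dimensions can be subtracted. -/
lemma exists_zariskiDim_eq_natCast [Finite σ] {V : Set (σ → K)} (hV : V.Nonempty) :
    ∃ d : ℕ, zariskiDim V = d := by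
  have hle : zariskiDim V ≤ Nat.card σ := by
    refine (zariskiDim_mono (Set.subset_univ V)).trans ?_
    rw [← Set.range_id]
    exact (zariskiDim_range_le_ringKrullDim _).trans (ringKrullDim_regularFunctions_le _)
  have hne : zariskiDim V ≠ ⊥ := by
    let := zariskiTopology K σ
    obtain ⟨v, hv⟩ := hV
    have : Nonempty (TopologicalSpace.IrreducibleCloseds V) :=
      ⟨⟨closure {⟨v, hv⟩}, isIrreducible_singleton.closure, isClosed_closure⟩⟩
    exact Order.bot_lt_krullDim.ne'
  obtain ⟨e, he⟩ := WithBot.ne_bot_iff_exists.1 hne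
  rw [← he] at hle ⊢
  have hle' : e ≤ (Nat.card σ : ℕ∞) := WithBot.coe_le_coe.1 hle
  obtain ⟨d, rfl⟩ := ENat.ne_top_iff_exists.1 (ne_top_of_le_ne_top (ENat.natCast_ne_top _) hle')
  exact ⟨d, rfl⟩

end Regular

/-! ### Regular maps and products of irreducible sets -/

section Morphisms

variable {K : Type*} [Field K] {X Y : Type*} {σ τ : Type*}

lemma eval_mem_of_coordinates_mem (B : Subalgebra K (X → K)) {u : X → τ → K}
    (hu : ∀ i, (fun x => u x i) ∈ B) (p : MvPolynomial τ K) : (fun x => eval (u x) p) ∈ B := by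
  induction p using MvPolynomial.induction_on with
  | C a => simp only [eval_C]; exact B.algebraMap_mem a
  | add p q hp hq => simp only [map_add]; exact B.add_mem hp hq
  | mul_X p i hp => simp only [map_mul, eval_X]; exact B.mul_mem hp (hu i)

/-- A map is regular if the coordinates of the image are regular functions. -/
def IsRegularMap (ι : X → σ → K) (κ : Y → τ → K) (φ : X → Y) : Prop :=
  ∀ i, (fun x => κ (φ x) i) ∈ regularFunctions ι

variable {ι : X → σ → K} {κ : Y → τ → K} {φ : X → Y}

lemma IsRegularMap.comp_mem (hφ : IsRegularMap ι κ φ) (f : regularFunctions κ) :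
    (f : Y → K) ∘ φ ∈ regularFunctions ι := by
  obtain ⟨p, rfl⟩ := ofPolynomial_surjective κ f
  convert eval_mem_of_coordinates_mem _ hφ p using 1
  ext x
  exact ofPolynomial_apply κ p (φ x)

/-- Composition with a regular map, on regular functions. -/
def IsRegularMap.pullback (hφ : IsRegularMap ι κ φ) : regularFunctions κ →+* regularFunctions ι where
  toFun f := ⟨(f : Y → K) ∘ φ, hφ.comp_mem f⟩
  map_one' := rfl
  map_zero' := rfl
  map_add' _ _ := rfl
  map_mul' _ _ := rfl

lemma IsRegularMap.pullback_apply (hφ : IsRegularMap ι κ φ) (f : regularFunctions κ) (x : X) :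
    (hφ.pullback f : X → K) x = (f : Y → K) (φ x) := rfl

lemma isRegularMap_const (ι : X → σ → K) (κ : Y → τ → K) (y : Y) :
    IsRegularMap ι κ fun _ => y :=
  fun i => (regularFunctions ι).algebraMap_mem (κ y i)

lemma IsRegularMap.isPrime_image (hφ : IsRegularMap ι κ φ) {T : Set X}
    (hT : (functionsVanishingOn ι T).IsPrime) : (functionsVanishingOn κ (φ '' T)).IsPrime := by
  have : functionsVanishingOn κ (φ '' T) = (functionsVanishingOn ι T).comap hφ.pullback := by
    ext f
    simp [mem_functionsVanishingOn, IsRegularMap.pullback_apply]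
  rw [this]
  infer_instance

/-- A product of irreducible sets is irreducible. -/
theorem isPrime_functionsVanishingOn_pi {n : ℕ} {π : (Fin n → X) → τ → K}
    (hπ : ∀ (u : Fin n → X) (a : Fin n), IsRegularMap ι π (Function.update u a))
    {T : Fin n → Set X} (hT : ∀ j, (functionsVanishingOn ι (T j)).IsPrime) :
    (functionsVanishingOn π (Set.univ.pi T)).IsPrime := by
  choose t ht using fun j => (isPrime_functionsVanishingOn_iff.1 (hT j)).1
  -- Induction on the set `s` of free coordinates, the others being frozen at `c`.
  have key : ∀ (s : Finset (Fin n)) (c : Fin n → X), (functionsVanishingOn π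
      {x | (∀ j ∈ s, x j ∈ T j) ∧ ∀ j ∉ s, x j = c j}).IsPrime := by
    intro s
    induction s using Finset.induction_on with
    | empty =>
      intro c
      convert functionsVanishingOn_singleton_isPrime π c using 2
      ext x
      simp [funext_iff]
    | insert a s ha ih =>
      intro c
      have mem_slice : ∀ (x : Fin n → X) (y : X),
          (∀ j ∈ insert a s, x j ∈ T j) → (∀ j ∉ insert a s, x j = c j) →
          Function.update x a y ∈ {x | (∀ j ∈ s, x j ∈ T j) ∧
            ∀ j ∉ s, x j = Function.update c a y j} := by
        intro x y hx hx'
        refine ⟨fun j hj => ?_, fun j hj => ?_⟩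
        · rw [Function.update_of_ne (ne_of_mem_of_not_mem hj ha)]
          exact hx j (Finset.mem_insert_of_mem hj)
        · by_cases hja : j = a
          · subst hja
            simp
          · rw [Function.update_of_ne hja, Function.update_of_ne hja]
            exact hx' j (by simp [hja, hj])
      refine isPrime_functionsVanishingOn_iff.2
        ⟨⟨fun j => if j ∈ insert a s then t j else c j, fun j hj => ?_, fun j hj => ?_⟩, ?_⟩
      · simpa only [hj, if_true] using ht j
      · simp only [hj, if_false]
      rintro f g ⟨x, ⟨hx, hx'⟩, hfx⟩ ⟨z, ⟨hz, hz'⟩, hgz⟩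
      -- Vary only coordinate `a`, in `x` for `f` and in `z` for `g`. Irreducibility of `T a` gives
      -- one value `y` that serves both, and the two modified points lie in a common slice with one
      -- free coordinate fewer.
      obtain ⟨y, hy, hfy, hgy⟩ := (isPrime_functionsVanishingOn_iff.1 (hT a)).2
        ((hπ x a).pullback f) ((hπ z a).pullback g)
        ⟨x a, hx a (Finset.mem_insert_self a s), by
          rwa [IsRegularMap.pullback_apply, Function.update_eq_self]⟩
        ⟨z a, hz a (Finset.mem_insert_self a s), by
          rwa [IsRegularMap.pullback_apply, Function.update_eq_self]⟩
      obtain ⟨w, ⟨hw, hw'⟩, hfw, hgw⟩ := (isPrime_functionsVanishingOn_iff.1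
        (ih (Function.update c a y))).2 f g
        ⟨_, mem_slice x y hx hx', hfy⟩ ⟨_, mem_slice z y hz hz', hgy⟩
      refine ⟨w, ⟨fun j hj => ?_, fun j hj => ?_⟩, hfw, hgw⟩
      · rcases Finset.mem_insert.1 hj with rfl | hj
        · rw [hw' j ha, Function.update_self]
          exact hy
        · exact hw j hj
      · rw [Finset.mem_insert, not_or] at hj
        rw [hw' j hj.2, Function.update_of_ne hj.1]
  convert key Finset.univ t using 2
  ext x
  simp

end Morphisms

/-! ### Word maps and powers of an algebraic group -/

section AlgebraicGroups

variable {K : Type*} [Field K] {G : Type*} [Group G]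

section RegularMaps

variable {X σ : Type*} {ι : X → σ → K} (A : AffineAlgebraicGroup K G)

lemma IsRegularMap.mul {φ ψ : X → G} (hφ : IsRegularMap ι A.coord φ)
    (hψ : IsRegularMap ι A.coord ψ) : IsRegularMap ι A.coord fun x => φ x * ψ x := fun i => by
  obtain ⟨P, hP⟩ := A.mul_regular i
  simp only [hP]
  exact eval_mem_of_coordinates_mem _ (u := fun x => Sum.elim (A.coord (φ x)) (A.coord (ψ x)))
    (Sum.rec hφ hψ) P

lemma IsRegularMap.inv {φ : X → G} (hφ : IsRegularMap ι A.coord φ) :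
    IsRegularMap ι A.coord fun x => (φ x)⁻¹ := fun i => by
  obtain ⟨P, hP⟩ := A.inv_regular i
  simp only [hP]
  exact eval_mem_of_coordinates_mem _ hφ P

lemma coordinate_mem_regularFunctions (ι : X → σ → K) (i : σ) :
    (fun x => ι x i) ∈ regularFunctions ι := by
  convert (ofPolynomial ι (MvPolynomial.X i)).2 using 1
  ext x
  simp [ofPolynomial_apply]

lemma isRegularMap_mul_left (a : G) : IsRegularMap A.coord A.coord fun y => a * y :=
  (isRegularMap_const A.coord A.coord a).mul A (coordinate_mem_regularFunctions A.coord)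

lemma isRegularMap_eval {m : ℕ} (j : Fin m) :
    IsRegularMap (A.powCoord m) A.coord fun x => x j :=
  fun i => coordinate_mem_regularFunctions (A.powCoord m) (j, i)

lemma isRegularMap_update {m : ℕ} (u : Fin m → G) (a : Fin m) :
    IsRegularMap A.coord (A.powCoord m) (Function.update u a) := by
  rintro ⟨j, i⟩
  by_cases hj : j = a
  · subst hj
    simpa [AffineAlgebraicGroup.powCoord] using coordinate_mem_regularFunctions A.coord i
  · simpa [AffineAlgebraicGroup.powCoord, hj] using isRegularMap_const A.coord A.coord (u j) i

/-- The evaluation of a word is a regular map `G^m → G`. -/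
lemma isRegularMap_wordEval {m : ℕ} (w : Monoid.Coprod G (FreeGroup (Fin m))) :
    IsRegularMap (A.powCoord m) A.coord fun x => wordEval x w := by
  induction w using Monoid.Coprod.induction_on with
  | inl g => simpa [wordEval] using isRegularMap_const (A.powCoord m) A.coord g
  | inr v =>
    simp only [wordEval, Monoid.Coprod.lift_apply_inr]
    induction v using FreeGroup.induction_on with
    | C1 => simpa using isRegularMap_const (A.powCoord m) A.coord 1
    | of j => simpa using isRegularMap_eval A j
    | inv_of j h => simpa using h.inv A
    | mul v v' h h' => simpa using h.mul A h'
  | mul v v' h h' => simpa using h.mul A h'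

lemma powCoord_injective (m : ℕ) : Function.Injective (A.powCoord m) := fun _ _ h =>
  funext fun j => A.coord_injective (funext fun i => congrFun h (j, i))

lemma isClosed_range_powCoord (m : ℕ) :
    IsClosed[zariskiTopology K (Fin m × Fin A.N)] (Set.range (A.powCoord m)) := by
  obtain ⟨J, hJ⟩ := isClosed_zariski_iff.1 A.isClosed_range
  refine isClosed_zariski_iff.2
    ⟨Ideal.span {q | ∃ j : Fin m, ∃ p ∈ J, q = rename (fun i => (j, i)) p}, ?_⟩
  rw [zeroLocus_span]
  ext v
  constructor
  · rintro ⟨x, rfl⟩ _ ⟨j, p, hp, rfl⟩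
    rw [aeval_rename]
    have hx : A.coord (x j) ∈ zeroLocus K J := hJ ▸ ⟨x j, rfl⟩
    exact hx p hp
  · intro hv
    have hmem : ∀ j : Fin m, (fun i => v (j, i)) ∈ Set.range A.coord := fun j => by
      rw [hJ]
      intro p hp
      have := hv _ ⟨j, p, hp, rfl⟩
      rwa [aeval_rename] at this
    choose x hx using hmem
    exact ⟨x, funext fun p => congrFun (hx p.1) p.2⟩

end RegularMaps

/-! ### Local dimension of powers of the group -/

section Dimension

variable [IsAlgClosed K] (A : AffineAlgebraicGroup K G)

lemma ringKrullDim_eq_dim : ringKrullDim (regularFunctions A.coord) = A.dim := by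
  refine le_antisymm ?_ (zariskiDim_range_le_ringKrullDim A.coord)
  have h := krullDim_primes_le_zariskiDim A.isClosed_range A.coord_injective (T := Set.univ)
    (Set.subset_univ _)
  rw [Set.image_univ] at h
  refine le_trans ?_ h
  refine Order.krullDim_le_of_strictMono (fun Q => ⟨Q, fun f hf => ?_⟩) fun _ _ h => h
  have : f = 0 := Subtype.ext (funext fun x => hf x trivial)
  rw [this]
  exact Q.asIdeal.zero_mem

/-- A maximal chain of primes of the algebra of regular functions of an algebraic group ends in
the ideal of a point. -/
lemma exists_ltSeries_length_eq_dim {d : ℕ} (hd : A.dim = d) :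
    ∃ (g : G) (p : LTSeries (PrimeSpectrum (regularFunctions A.coord))),
      p.length = d ∧ p.last.asIdeal = functionsVanishingOn A.coord {g} := by
  have hdim := (ringKrullDim_eq_dim A).trans hd
  have : FiniteRingKrullDim (regularFunctions A.coord) := by
    rw [finiteRingKrullDim_iff_ne_bot_and_top, hdim]
    exact ⟨WithBot.natCast_ne_bot d, by
      rw [← WithBot.coe_natCast, ← WithBot.coe_top, Ne, WithBot.coe_inj]
      exact ENat.natCast_ne_top d⟩
  obtain ⟨M, hM, hheight⟩ := Ideal.exists_isMaximal_height (R := regularFunctions A.coord)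
  obtain ⟨g, hg⟩ := exists_eq_functionsVanishingOn_singleton A.isClosed_range M
  have hMd : M.height = d := by
    rw [hdim] at hheight
    exact WithBot.coe_injective hheight
  obtain ⟨p, hp, hlen⟩ := Order.exists_series_of_le_height
    (⟨M, hM.isPrime⟩ : PrimeSpectrum (regularFunctions A.coord)) (n := d) (by
      rw [← PrimeSpectrum.height_eq_orderHeight, hMd])
  exact ⟨g, p, hlen, by rw [hp, ← hg]⟩

/-- The local dimension of `G^m` at each of its points is at least `m * dim G`. -/
theorem mul_dim_le_height {d : ℕ} (hd : A.dim = d) (m : ℕ) (c : Fin m → G) :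
    ((m * d : ℕ) : ℕ∞) ≤ (functionsVanishingOn (A.powCoord m) {c}).height := by
  obtain ⟨g, p, hlen, hlast⟩ := exists_ltSeries_length_eq_dim A hd
  -- The chain indexed by all of `ℕ`, constant from index `d` on.
  let q : ℕ → PrimeSpectrum (regularFunctions A.coord) := fun k =>
    p ⟨min k p.length, by omega⟩
  have hq : ∀ k < d, q k < q (k + 1) := fun k hk =>
    p.strictMono (by simp only [Fin.mk_lt_mk]; omega)
  have hqd : (q d).asIdeal = functionsVanishingOn A.coord {g} := by
    rw [← hlast]
    congr 1
    exact congrArg p (Fin.ext (by simp [hlen]))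
  -- The chain shrinks to the point `g`; left translation by `c j * g⁻¹` makes it shrink to `c j`
  -- instead.
  let T : ℕ → Fin m → Set G := fun k j => (fun y => c j * g⁻¹ * y) '' zeros (q k).asIdeal
  have hT : ∀ k j, (functionsVanishingOn A.coord (T k j)).IsPrime := fun k j => by
    refine (isRegularMap_mul_left A (c j * g⁻¹)).isPrime_image ?_
    rw [functionsVanishingOn_zeros A.isClosed_range]
    infer_instance
  let F : (Fin m → ℕ) → PrimeSpectrum (regularFunctions (A.powCoord m)) := fun k =>
    ⟨functionsVanishingOn (A.powCoord m) (Set.univ.pi fun j => T (k j) j),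
      isPrime_functionsVanishingOn_pi (isRegularMap_update A) fun j => hT (k j) j⟩
  have hF : ∀ (k : Fin m → ℕ) (a : Fin m), k a < d →
      F k < F (Function.update k a (k a + 1)) := by
    intro k a ha
    have hlt : (q (k a)).asIdeal < (q (k a + 1)).asIdeal := hq _ ha
    refine lt_of_le_not_ge (functionsVanishingOn_anti fun x hx j _ => ?_) fun hge => ?_
    · have : x j ∈ T (Function.update k a (k a + 1) j) j := hx j trivial
      change x j ∈ T (k j) j
      by_cases hj : j = a
      · subst hj
        rw [Function.update_self] at this
        exact Set.image_mono (zeros_anti hlt.le) this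
      · rwa [Function.update_of_ne hj] at this
    -- Strictness: a function separating two consecutive primes of the chain, translated back and
    -- applied to coordinate `a`, separates the products. The points `t j` fill the other
    -- coordinates.
    · obtain ⟨f, hf, hf'⟩ := SetLike.exists_of_lt hlt
      rw [← functionsVanishingOn_zeros A.isClosed_range (q (k a)).asIdeal,
        mem_functionsVanishingOn] at hf'
      push Not at hf'
      obtain ⟨z, hz, hfz⟩ := hf'
      choose t ht using fun j => (isPrime_functionsVanishingOn_iff.1 (hT (k j) j)).1
      have hreg : IsRegularMap (A.powCoord m) A.coord fun x => (c a * g⁻¹)⁻¹ * x a :=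
        (isRegularMap_const _ _ _).mul A (isRegularMap_eval A a)
      have hmem : hreg.pullback f ∈ (F (Function.update k a (k a + 1))).asIdeal := fun x hx => by
        have hxa : x a ∈ T (Function.update k a (k a + 1) a) a := hx a trivial
        rw [Function.update_self] at hxa
        obtain ⟨y, hy, hyx⟩ := hxa
        rw [IsRegularMap.pullback_apply, ← hyx, inv_mul_cancel_left]
        exact hy f hf
      refine hfz ?_
      have := hge hmem (Function.update t a (c a * g⁻¹ * z)) fun j _ => by
        by_cases hj : j = a
        · subst hj
          rw [Function.update_self]
          exact ⟨z, hz, rfl⟩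
        · rw [Function.update_of_ne hj]
          exact ht j
      rwa [IsRegularMap.pullback_apply, Function.update_self, inv_mul_cancel_left] at this
  -- Each unit step in one coordinate is a strict inclusion of primes, so the height is at least the
  -- coordinate sum.
  have hsum : ∀ (s : ℕ) (k : Fin m → ℕ), (∀ j, k j ≤ d) → ∑ j, k j = s →
      (s : ℕ∞) ≤ Order.height (F k) := by
    intro s
    induction s with
    | zero => intros; simp
    | succ s ih =>
      intro k hk hs
      obtain ⟨a, -, ha⟩ := Finset.exists_ne_zero_of_sum_ne_zero (hs.trans_ne s.succ_ne_zero)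
      have hlt := hF (Function.update k a (k a - 1)) a (by
        have := hk a
        rw [Function.update_self]
        omega)
      rw [Function.update_self, Function.update_idem, Nat.sub_add_cancel (by omega),
        Function.update_eq_self] at hlt
      refine le_trans ?_ (Order.height_add_one_le hlt)
      rw [Nat.cast_add_one]
      gcongr
      refine ih _ (fun j => ?_) ?_
      · by_cases hj : j = a
        · subst hj
          rw [Function.update_self]
          have := hk j
          omega
        · rw [Function.update_of_ne hj]
          exact hk j
      · rw [Finset.sum_update_of_mem (Finset.mem_univ a)]
        rw [← Finset.add_sum_erase _ _ (Finset.mem_univ a), ← Finset.sdiff_singleton_eq_erase] at hs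
        omega
  have htop := hsum (m * d) (fun _ => d) (fun _ => le_rfl) (by simp)
  have hpoint : F (fun _ => d) = ⟨functionsVanishingOn (A.powCoord m) {c}, inferInstance⟩ := by
    refine PrimeSpectrum.ext ?_
    change functionsVanishingOn _ _ = functionsVanishingOn _ _
    congr 1
    rw [← Set.univ_pi_singleton]
    congr 1
    ext j : 1
    simp [T, hqd, zeros_functionsVanishingOn_singleton A.coord_injective]
  rw [hpoint, ← PrimeSpectrum.height_eq_orderHeight] at htop
  exact htop

end Dimension

end AlgebraicGroups

/-! ### Cutting down by equations near a point of the component -/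

/-- An irreducible component of a closed set has a point on no other irreducible component. -/
theorem exists_mem_zeros_forall_le {K : Type*} [Field K] [IsAlgClosed K] {X σ : Type*} [Finite σ]
    {ι : X → σ → K} (hι : IsClosed[zariskiTopology K σ] (Set.range ι)) {S : Set X}
    (hS : zeros (functionsVanishingOn ι S) ⊆ S) {P : Ideal (regularFunctions ι)} [hP : P.IsPrime]
    (hmin : ∀ Q : Ideal (regularFunctions ι), Q.IsPrime → zeros Q ⊆ S → Q ≤ P → P ≤ Q) :
    ∃ c ∈ zeros P, ∀ Q : Ideal (regularFunctions ι), Q.IsPrime → zeros Q ⊆ S →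
      Q ≤ functionsVanishingOn ι {c} → P ≤ Q := by
  classical
  have hfin := Ideal.finite_minimalPrimes_of_isNoetherianRing _ (functionsVanishingOn ι S)
  -- Prime avoidance: the product of these functions over the finitely many minimal primes is
  -- outside `P`, yet lies in every minimal prime not contained in `P`. The point `c` is chosen
  -- where it does not vanish.
  have hex : ∀ Q : Ideal (regularFunctions ι), ∃ f, f ∉ P ∧ (¬Q ≤ P → f ∈ Q) := fun Q => by
    by_cases hQ : Q ≤ P
    · exact ⟨1, (Ideal.ne_top_iff_one _).1 hP.ne_top, fun h => absurd hQ h⟩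
    · obtain ⟨f, hf, hf'⟩ := SetLike.not_le_iff_exists.1 hQ
      exact ⟨f, hf', fun _ => hf⟩
  choose f hfP hf using hex
  have hprod : ∏ Q ∈ hfin.toFinset, f Q ∉ P := by
    rw [hP.prod_mem_iff]
    rintro ⟨Q, -, hQ⟩
    exact hfP Q hQ
  rw [← functionsVanishingOn_zeros hι P, mem_functionsVanishingOn] at hprod
  push Not at hprod
  obtain ⟨c, hc, hprodc⟩ := hprod
  refine ⟨c, hc, fun Q hQ hQS hQc => ?_⟩
  have hle : functionsVanishingOn ι S ≤ Q :=
    (functionsVanishingOn_anti hQS).trans (functionsVanishingOn_zeros hι Q).le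
  obtain ⟨Q', hQ', hQ'Q⟩ := Ideal.exists_minimalPrimes_le hle
  refine le_trans (hmin Q' hQ'.1.1 ((zeros_anti hQ'.1.2).trans hS) ?_) hQ'Q
  by_contra hcon
  refine hprodc ?_
  have : ∏ Q ∈ hfin.toFinset, f Q ∈ functionsVanishingOn ι {c} :=
    hQc (hQ'Q (Ideal.prod_mem _ (hfin.mem_toFinset.2 hQ') (hf Q' hcon)))
  exact this c rfl

/-- The height of the image of a prime `N` in the quotient by `I` is bounded by the lengths of the
chains of primes above `P`, if `P` lies below all primes between `I` and `N`. -/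
theorem height_map_quotientMk_le {R : Type*} [CommRing R] {I P N : Ideal R} [N.IsPrime]
    (hIN : I ≤ N) (hP : ∀ Q : Ideal R, Q.IsPrime → I ≤ Q → Q ≤ N → P ≤ Q) :
    ((N.map (Ideal.Quotient.mk I)).height : WithBot ℕ∞) ≤
      Order.krullDim {Q : PrimeSpectrum R // P ≤ Q.asIdeal} := by
  have hprime := Ideal.isPrime_map_quotientMk_of_isPrime hIN
  have hcomap : (N.map (Ideal.Quotient.mk I)).comap (Ideal.Quotient.mk I) = N := by
    rw [Ideal.comap_map_of_surjective _ Ideal.Quotient.mk_surjective, ← RingHom.ker_eq_comap_bot,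
      Ideal.mk_ker, sup_eq_left.2 hIN]
  let N' : PrimeSpectrum (R ⧸ I) := ⟨N.map (Ideal.Quotient.mk I), hprime⟩
  rw [show (N.map (Ideal.Quotient.mk I)).height = Order.height N' from
    PrimeSpectrum.height_eq_orderHeight N', Order.height_eq_krullDim_Iic]
  refine Order.krullDim_le_of_strictMono (fun Q => ⟨Q.1.comap (Ideal.Quotient.mk I),
    hP _ inferInstance (fun f hf => ?_) (fun f hf => ?_)⟩) fun Q Q' h => ?_
  · change Ideal.Quotient.mk I f ∈ Q.1.asIdeal
    rw [Ideal.Quotient.eq_zero_iff_mem.2 hf]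
    exact Q.1.asIdeal.zero_mem
  · rw [← hcomap]
    exact Q.2 hf
  · refine lt_of_le_not_ge (Ideal.comap_mono h.le) fun hge => h.not_ge ?_
    exact (Ideal.comap_le_comap_iff_of_surjective _ Ideal.Quotient.mk_surjective _ _).1 hge

theorem mul_dim_le_dim_add_mul_dim {K : Type*} [Field K] [IsAlgClosed K] {G : Type*} [Group G]
    (A : AffineAlgebraicGroup K G) {m n : ℕ} (w : Fin n → Monoid.Coprod G (FreeGroup (Fin m)))
    {C : Set (Fin m × Fin A.N → K)} (hC : C ∈ zariskiComponents (solutionVariety A w)) {c d : ℕ}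
    (hc : zariskiDim C = c) (hd : A.dim = d) : m * d ≤ c + n * d := by
  classical
  obtain ⟨⟨hirr, hsub⟩, hmax⟩ := hC
  obtain ⟨T, hTS, rfl⟩ := Set.subset_image_iff.1 hsub
  have hclosed := isClosed_range_powCoord A m
  have hP := isIrreducible_image_iff.1 hirr
  -- Maximality of the component, restated for primes; closedness of `T` follows from it below.
  have hmaxT : ∀ Q : Ideal (regularFunctions (A.powCoord m)), Q.IsPrime → T ⊆ zeros Q →
      zeros Q ⊆ solutionSet w → zeros Q ⊆ T := fun Q hQ hTQ hQS => by
    rw [← Set.image_subset_image_iff (powCoord_injective A m)]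
    have hQ' := isIrreducible_image_iff.2 ((functionsVanishingOn_zeros hclosed Q).symm ▸ hQ)
    exact hmax ⟨hQ', Set.image_mono hQS⟩ (Set.image_mono hTQ)
  have hone : ∀ (g : G), (∀ f ∈ functionsVanishingOn A.coord {1}, (f : G → K) g = 0) → g = 1 :=
    fun g hg => by
      have : g ∈ zeros (functionsVanishingOn A.coord {1}) := hg
      rwa [zeros_functionsVanishingOn_singleton A.coord_injective] at this
  let φ := fun i => (isRegularMap_wordEval A (w i)).pullback
  have hsol : zeros (functionsVanishingOn (A.powCoord m) (solutionSet w)) ⊆ solutionSet w :=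
    fun x hx i => hone _ fun f hf => hx (φ i f) fun y hy => by
      rw [IsRegularMap.pullback_apply, hy i]
      exact hf 1 rfl
  have hTzeros : zeros (functionsVanishingOn (A.powCoord m) T) ⊆ T :=
    hmaxT _ hP (subset_zeros_functionsVanishingOn _ _)
      ((zeros_anti (functionsVanishingOn_anti hTS)).trans hsol)
  obtain ⟨x, hxT, hx⟩ := exists_mem_zeros_forall_le hclosed hsol
    (P := functionsVanishingOn (A.powCoord m) T) fun Q hQ hQS hQP => by
      rw [← functionsVanishingOn_zeros hclosed Q]
      exact functionsVanishingOn_anti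
        (hmaxT Q hQ ((subset_zeros_functionsVanishingOn _ _).trans (zeros_anti hQP)) hQS)
  have hxS : x ∈ solutionSet w := hTS (hTzeros hxT)
  -- Converse of Krull's height theorem: the ideal of `1` is minimal over the span of `s`. It need
  -- not equal that span.
  obtain ⟨s, hs, hcard⟩ :=
    (functionsVanishingOn A.coord {(1 : G)}).exists_finset_card_eq_height_of_isNoetherianRing
  have hsd : s.card ≤ d := by
    have h := Ideal.height_le_ringKrullDim_of_isPrime (I := functionsVanishingOn A.coord {(1 : G)})
    rw [ringKrullDim_eq_dim, hd, ← hcard] at h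
    exact_mod_cast h
  let E : Finset (regularFunctions (A.powCoord m)) :=
    (Finset.univ ×ˢ s).image fun p : Fin n × _ => φ p.1 p.2
  have hE : E.card ≤ n * d := Finset.card_image_le.trans (by
    rw [Finset.card_product, Finset.card_univ, Fintype.card_fin]
    gcongr)
  have hEx : Ideal.span (E : Set (regularFunctions (A.powCoord m))) ≤
      functionsVanishingOn (A.powCoord m) {x} := by
    rw [Ideal.span_le]
    intro f hf
    obtain ⟨⟨i, f⟩, hif, rfl⟩ := Finset.mem_image.1 hf
    rintro _ rfl
    rw [IsRegularMap.pullback_apply, hxS i]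
    exact hs.1.2 (Ideal.subset_span (Finset.mem_product.1 hif).2) 1 rfl
  have hbelow : ∀ Q : Ideal (regularFunctions (A.powCoord m)), Q.IsPrime →
      Ideal.span (E : Set (regularFunctions (A.powCoord m))) ≤ Q →
      Q ≤ functionsVanishingOn (A.powCoord m) {x} →
      functionsVanishingOn (A.powCoord m) T ≤ Q := fun Q hQ hEQ hQx => by
    refine hx Q hQ (fun y hy i => hone _ fun f hf => hy (φ i f) ?_) hQx
    -- Each word map sends `x` to `1`, so the contraction of `Q` stays below the ideal of `1`;
    -- minimality over the span of `s` then forces equality.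
    have hle : Q.comap (φ i) ≤ functionsVanishingOn A.coord {1} := by
      rintro f hf _ rfl
      have := hQx hf x rfl
      rwa [IsRegularMap.pullback_apply, hxS i] at this
    have hspan : Ideal.span (s : Set (regularFunctions A.coord)) ≤ Q.comap (φ i) := by
      rw [Ideal.span_le]
      exact fun f hf => hEQ (Ideal.subset_span (Finset.mem_coe.2 (Finset.mem_image.2
        ⟨(i, f), Finset.mem_product.2 ⟨Finset.mem_univ i, hf⟩, rfl⟩)))
    exact hs.2 ⟨hQ.comap (φ i), hspan⟩ hle hf
  have hlow := mul_dim_le_height A hd m x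
  have hsub' : (E : Set (regularFunctions (A.powCoord m))) ⊆
      functionsVanishingOn (A.powCoord m) {x} := Ideal.span_le.1 hEx
  -- Passing to the quotient by the functions in `E` lowers the height by at most their number.
  have hup := Ideal.height_le_height_add_encard_of_subset
    (E : Set (regularFunctions (A.powCoord m))) hsub'
  have hquot := (height_map_quotientMk_le hEx hbelow).trans
    (krullDim_primes_le_zariskiDim hclosed (powCoord_injective A m) hTzeros)
  rw [hc] at hquot
  have hquot' : _ ≤ (c : ℕ∞) := WithBot.coe_le_coe.1 hquot
  rw [Set.encard_coe_eq_coe_finsetCard] at hup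
  have hfinal : ((m * d : ℕ) : ℕ∞) ≤ ((c + n * d : ℕ) : ℕ∞) := by
    refine (hlow.trans hup).trans ?_
    rw [Nat.cast_add]
    gcongr
  exact_mod_cast hfinal

end AlgGroupEq

end

theorem theorem0 {K : Type*} [Field K] [IsAlgClosed K] {G : Type*} [Group G]
    (A : AlgGroupEq.AffineAlgebraicGroup K G) (m n : ℕ)
    (w : Fin n → Monoid.Coprod G (FreeGroup (Fin m)))
    (C : Set (Fin m × Fin A.N → K))
    (hC : C ∈ AlgGroupEq.zariskiComponents (AlgGroupEq.solutionVariety A w)) :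
    ∃ c d : ℕ, AlgGroupEq.zariskiDim C = c ∧ A.dim = d ∧
      ((m : ℤ) - (n : ℤ)) * (d : ℤ) ≤ (c : ℤ) := by
  obtain ⟨c, hc⟩ := AlgGroupEq.exists_zariskiDim_eq_natCast hC.1.1.1
  obtain ⟨d, hd⟩ := AlgGroupEq.exists_zariskiDim_eq_natCast (Set.range_nonempty A.coord)
  have h := AlgGroupEq.mul_dim_le_dim_add_mul_dim A w hC hc hd
  refine ⟨c, d, hc, hd, ?_⟩
  zify at h
  linarith
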